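/- Let $p$ be a prime, let $k$ be a field of characteristic $p$, and let $F/\mathbb{Q}_p$ be a finite extension with normalized discrete valuation $v_F : F^\times \to \mathbb{Z}$ and ring of integers $O_F$. For a $p$-adic Lie group $G$, the augmented Iwasawa algebra is $kG = k[G] \otimes_{k[H]} kH$, where $H \le G$ is any compact open subgroup and $kH = \varprojlim_N k[H/N]$ ($N$ running over the open normal subgroups of $H$); equivalently, $kG$ is the convolution algebra of compactly supported $k$-valued distributions on $G$ (linear forms on the locally constant functions $G \to k$ that depend only on the restriction of a function to some compact set). A ring is left (right) coherent if each of its finitely generated left (right) ideals is finitely presented. Let $$U_3' = \begin{pmatrix} 1 & 0 & F \\ 0 & 1 & F \\ 0 & 0 & 1 \end{pmatrix} \le GL_3(F),$$ let $u, v \in F^\times$ satisfy $v_F(u) > 0$ and $v_F(v) < 0$, and put $t' = \mathrm{diag}(u, v, 1)$ and $G_{3,t'} = \langle t', U_3' \rangle \le GL_3(F)$, with the subspace topology. Then the augmented Iwasawa algebra $kG_{3,t'}$ is not coherent: it is neither left coherent nor right coherent. More precisely, let $g = (t')^{v_F(p)}$, let $G_{3,g} = \langle g, U_3' \rangle$,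 let $x_0, \dots, x_{n-1}$ be a basis of $O_F$ over $\mathbb{Z}_p$, and let $s_i = h_i - 1$, $t_i = h_i' - 1$ in $kG_{3,g}$, where $h_i$ (respectively $h_i'$) is the unitriangular matrix whose only non-zero off-diagonal entry is $x_i$ in position $(1,3)$ (respectively $(2,3)$). Then the left ideal $I_g$ of $kG_{3,g}$ generated by $s_0, \dots, s_{n-1}, t_0, \dots, t_{n-1}$ and $g - 1$ is finitely generated but not finitely presented. -/

import Mathlib

open scoped WithZero

section AugmentedIwasawa

variable (k : Type*) [Field k] (G : Type*) [TopologicalSpace G]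

/-- The space of compactly supported `k`-valued distributions on `G`: linear forms `μ` on the space
of locally constant functions `G → k` for which there is a compact set `C` such that `μ f = 0`
whenever `f` vanishes on `C`. -/
def compactDistributions : Submodule k (LocallyConstant G k →ₗ[k] k) where
  carrier := {μ | ∃ C : Set G, IsCompact C ∧ ∀ f : LocallyConstant G k, (∀ x ∈ C, f x = 0) → μ f = 0}
  zero_mem' := ⟨∅, isCompact_empty, fun _ _ => rfl⟩
  add_mem' := by
    rintro μ ν ⟨C, hC, hμ⟩ ⟨D, hD, hν⟩
    refine ⟨C ∪ D, hC.union hD, fun f hf => ?_⟩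
    rw [LinearMap.add_apply, hμ f fun x hx => hf x (Or.inl hx), hν f fun x hx => hf x (Or.inr hx),
      add_zero]
  smul_mem' := by
    rintro a μ ⟨C, hC, hμ⟩
    exact ⟨C, hC, fun f hf => by rw [LinearMap.smul_apply, hμ f hf, smul_zero]⟩

/-- The augmented Iwasawa algebra `kG` (as a vector space; the product is below), realised as the algebra of compactly supported `k`-valued
distributions on `G` under convolution `(μ * ν) f = μ (x ↦ ν (y ↦ f (x * y)))`. -/
def AugmentedIwasawaAlgebra : Type _ := compactDistributions k G

namespace AugmentedIwasawaAlgebra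

noncomputable instance : AddCommGroup (AugmentedIwasawaAlgebra k G) :=
  inferInstanceAs (AddCommGroup (compactDistributions k G))

noncomputable instance : Module k (AugmentedIwasawaAlgebra k G) :=
  inferInstanceAs (Module k (compactDistributions k G))

variable {k G}

/-- The linear form underlying an element of `kG`. -/
def toLin : AugmentedIwasawaAlgebra k G →ₗ[k] LocallyConstant G k →ₗ[k] k :=
  (compactDistributions k G).subtype

theorem ext {μ ν : AugmentedIwasawaAlgebra k G} (h : ∀ f, toLin μ f = toLin ν f) : μ = ν :=
  Subtype.ext (LinearMap.ext h)

theorem exists_compact (μ : AugmentedIwasawaAlgebra k G) : ∃ C : Set G, IsCompact C ∧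
    ∀ f : LocallyConstant G k, (∀ x ∈ C, f x = 0) → toLin μ f = 0 := μ.2

theorem toLin_congr (μ : AugmentedIwasawaAlgebra k G) {C : Set G}
    (hC : ∀ f : LocallyConstant G k, (∀ x ∈ C, f x = 0) → toLin μ f = 0)
    {f f' : LocallyConstant G k} (h : ∀ x ∈ C, f x = f' x) : toLin μ f = toLin μ f' := by
  rw [← sub_eq_zero, ← map_sub]
  exact hC _ fun x hx => sub_eq_zero.2 (h x hx)

/-- The Dirac distribution at `g`, i.e. the element of `kG` given by the group element `g`. -/
def dirac (g : G) : AugmentedIwasawaAlgebra k G :=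
  ⟨LocallyConstant.evalₗ k g, {g}, isCompact_singleton, fun _ hf => hf g rfl⟩

theorem toLin_dirac (g : G) (f : LocallyConstant G k) : toLin (dirac g) f = f g := rfl

variable [Group G] [IsTopologicalGroup G]

/-- The function `y ↦ f (x * y)`. -/
def translate (x : G) (f : LocallyConstant G k) : LocallyConstant G k :=
  f.comap ⟨fun y => x * y, continuous_const_mul x⟩

/-- The function `x ↦ ν (y ↦ f (x * y))`, which is locally constant as `ν` has compact support. -/
noncomputable def convolve (ν : AugmentedIwasawaAlgebra k G) : LocallyConstant G k →ₗ[k] LocallyConstant G k where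
  toFun f :=
    { toFun := fun x => toLin ν (translate x f)
      isLocallyConstant := by
        rw [IsLocallyConstant.iff_eventually_eq]
        intro x
        obtain ⟨C, hC, hν⟩ := ν.exists_compact
        have : ∀ᶠ x' in nhds x, ∀ y ∈ C, f (x' * y) = f (x * y) := by
          refine hC.eventually_forall_of_forall_eventually fun y _ => ?_
          have h1 : ∀ᶠ q : G × G in nhds (x, y), f (q.1 * q.2) = f (x * y) :=
            (continuous_mul.tendsto (x, y)).eventually (f.isLocallyConstant.eventually_eq (x * y))
          have h2 : ∀ᶠ q : G × G in nhds (x, y), f (x * q.2) = f (x * y) :=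
            ((continuous_const.mul continuous_snd).tendsto (x, y)).eventually
              (f.isLocallyConstant.eventually_eq (x * y))
          filter_upwards [h1, h2] with q h1 h2 using h1.trans h2.symm
        filter_upwards [this] with x' hx'
        exact toLin_congr ν hν hx' }
  map_add' f g := by ext x; exact map_add (toLin ν) (translate x f) (translate x g)
  map_smul' a f := by ext x; exact map_smul (toLin ν) a (translate x f)

theorem convolve_apply (ν : AugmentedIwasawaAlgebra k G) (f : LocallyConstant G k) (x : G) :
    convolve ν f x = toLin ν (translate x f) := rfl

noncomputable instance : Mul (AugmentedIwasawaAlgebra k G) where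
  mul μ ν := ⟨toLin μ ∘ₗ convolve ν, by
    obtain ⟨C, hC, hμ⟩ := μ.exists_compact
    obtain ⟨D, hD, hν⟩ := ν.exists_compact
    refine ⟨(fun q : G × G => q.1 * q.2) '' C ×ˢ D, (hC.prod hD).image continuous_mul,
      fun f hf => hμ _ fun x hx => hν _ fun y hy => hf _ ⟨(x, y), ⟨hx, hy⟩, rfl⟩⟩⟩

instance : One (AugmentedIwasawaAlgebra k G) := ⟨dirac 1⟩

theorem toLin_mul (μ ν : AugmentedIwasawaAlgebra k G) (f : LocallyConstant G k) :
    toLin (μ * ν) f = toLin μ (convolve ν f) := rfl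

noncomputable instance : Ring (AugmentedIwasawaAlgebra k G) :=
  { (inferInstance : AddCommGroup (AugmentedIwasawaAlgebra k G)) with
    one := 1
    mul := (· * ·)
    left_distrib μ ν ρ := ext fun f => by
      rw [toLin_mul, map_add, LinearMap.add_apply, toLin_mul, toLin_mul, ← map_add]
      rfl
    right_distrib μ ν ρ := ext fun f => by
      simp only [toLin_mul, map_add, LinearMap.add_apply]
    zero_mul μ := ext fun f => by simp only [toLin_mul, map_zero, LinearMap.zero_apply]
    mul_zero μ := ext fun f => by
      rw [toLin_mul, show convolve 0 f = (0 : LocallyConstant G k) from rfl]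
      simp only [map_zero, LinearMap.zero_apply]
    mul_assoc μ ν ρ := ext fun f => congrArg (toLin μ) <| LocallyConstant.ext fun x =>
      congrArg (toLin ν) <| LocallyConstant.ext fun y => congrArg (toLin ρ) <|
        LocallyConstant.ext fun z => congrArg f (mul_assoc x y z)
    one_mul μ := ext fun f => congrArg (toLin μ) <| LocallyConstant.ext fun x =>
      congrArg f (one_mul x)
    mul_one μ := ext fun f => congrArg (toLin μ) <| LocallyConstant.ext fun x =>
      congrArg f (mul_one x) }

noncomputable instance : Algebra k (AugmentedIwasawaAlgebra k G) :=
  Algebra.ofModule (fun a μ ν => ext fun f => by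
      simp only [toLin_mul, map_smul, LinearMap.smul_apply])
    (fun a μ ν => ext fun f => by
      rw [toLin_mul, map_smul, LinearMap.smul_apply, toLin_mul, ← map_smul]
      congr 1)

theorem dirac_mul (g h : G) : (dirac (g * h) : AugmentedIwasawaAlgebra k G) = dirac g * dirac h :=
  rfl

variable {H : Subgroup G}

/-- The inclusion `kH → kG` for a subgroup `H` of `G` (extension of distributions by zero). -/
noncomputable def ofSubgroup (H : Subgroup G) : AugmentedIwasawaAlgebra k H →ₐ[k] AugmentedIwasawaAlgebra k G :=
  AlgHom.ofLinearMap
    { toFun := fun μ => ⟨toLin μ ∘ₗ LocallyConstant.comapₗ k ⟨Subtype.val, continuous_subtype_val⟩, by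
        obtain ⟨C, hC, hμ⟩ := μ.exists_compact
        exact ⟨Subtype.val '' C, hC.image continuous_subtype_val,
          fun f hf => hμ _ fun x hx => hf x ⟨x, hx, rfl⟩⟩⟩
      map_add' := fun _ _ => rfl
      map_smul' := fun _ _ => rfl }
    rfl (fun _ _ => rfl)

theorem toLin_ofSubgroup (μ : AugmentedIwasawaAlgebra k H) (f : LocallyConstant G k) :
    toLin (ofSubgroup H μ) f = toLin μ (f.comap ⟨Subtype.val, continuous_subtype_val⟩) := rfl

open Classical in
/-- The function supported on `g H` given there by `g * h ↦ f h`. -/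
noncomputable def extend (hH : IsOpen (H : Set G)) (g : G) (f : LocallyConstant H k) :
    LocallyConstant G k where
  toFun x := if hx : g⁻¹ * x ∈ H then f ⟨g⁻¹ * x, hx⟩ else 0
  isLocallyConstant := by
    rw [IsLocallyConstant.iff_exists_open]
    intro x
    have hc : Continuous fun y : G => g⁻¹ * y := continuous_const_mul _
    by_cases hx : g⁻¹ * x ∈ H
    · obtain ⟨U, hU, hxU, hfU⟩ := (IsLocallyConstant.iff_exists_open _).1 f.isLocallyConstant
        ⟨g⁻¹ * x, hx⟩
      refine ⟨_, ((hH.isOpenEmbedding_subtypeVal.isOpenMap U hU).preimage hc), ⟨_, hxU, rfl⟩, ?_⟩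
      rintro y ⟨z, hz, hzy⟩
      have hy : g⁻¹ * y ∈ H := by rw [← show (z : G) = g⁻¹ * y from hzy]; exact z.2
      have hzy' : z = ⟨g⁻¹ * y, hy⟩ := Subtype.ext hzy
      simp only [dif_pos hx, dif_pos hy]
      exact hfU _ (hzy' ▸ hz)
    · refine ⟨_, (H.isClosed_of_isOpen hH).isOpen_compl.preimage hc, hx, fun y hy => ?_⟩
      rw [dif_neg hx, dif_neg (show g⁻¹ * y ∉ H from hy)]

open Classical in
theorem extend_mul (hH : IsOpen (H : Set G)) (g : G) (f : LocallyConstant H k) (h : H) :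
    extend hH g f (g * h) = f h := by
  have h1 : g⁻¹ * (g * h) = h := inv_mul_cancel_left g h
  have : g⁻¹ * (g * (h : G)) ∈ H := by rw [h1]; exact h.2
  show (if hx : g⁻¹ * (g * h) ∈ H then f ⟨g⁻¹ * (g * h), hx⟩ else 0) = f h
  rw [dif_pos this]
  exact congrArg f (Subtype.ext h1)

theorem extend_of_notMem (hH : IsOpen (H : Set G)) (g : G) (f : LocallyConstant H k) {x : G}
    (hx : g⁻¹ * x ∉ H) : extend hH g f x = 0 := dif_neg hx

/-- For an open subgroup `H`, the map `k[G] ⊗_{k[H]} kH → kG`, `g ⊗ μ ↦ dirac g * μ`, is bijective: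
every element of `kG` is uniquely a finite sum of terms `dirac g * μ` with `μ ∈ kH` and `g` in a
system of representatives of `G ⧸ H`. -/
theorem existsUnique_decomposition (hH : IsOpen (H : Set G)) (x : AugmentedIwasawaAlgebra k G) :
    ∃! y : (G ⧸ H) →₀ AugmentedIwasawaAlgebra k H,
      x = y.sum fun c μ => dirac c.out * ofSubgroup H μ := by
  have eval_sum : ∀ (y : (G ⧸ H) →₀ AugmentedIwasawaAlgebra k H) (f : LocallyConstant G k),
      toLin (y.sum fun c μ => dirac c.out * ofSubgroup H μ) f =
        y.sum fun c μ => toLin μ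
          ((translate c.out f).comap ⟨Subtype.val, continuous_subtype_val⟩) := by
    intro y f
    simp only [Finsupp.sum, map_sum, LinearMap.sum_apply]
    rfl
  have mem_iff : ∀ (c : G ⧸ H) (g : G), c.out⁻¹ * g ∈ H ↔ (g : G ⧸ H) = c := by
    intro c g
    rw [← QuotientGroup.eq, QuotientGroup.out_eq', eq_comm]
  refine existsUnique_of_exists_of_unique ?_ ?_
  · obtain ⟨C, hC, hx⟩ := x.exists_compact
    have hfin : ((fun g : G => (g : G ⧸ H)) '' C).Finite := by
      have := QuotientGroup.discreteTopology hH
      exact (hC.image QuotientGroup.continuous_mk).finite_of_discrete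
    let y₀ : G ⧸ H → AugmentedIwasawaAlgebra k H := fun c =>
      ⟨{ toFun := fun f => toLin x (extend hH c.out f)
         map_add' := fun f f' => by
          rw [← map_add]
          congr 1
          ext z
          by_cases hz : c.out⁻¹ * z ∈ H
          · obtain ⟨h, rfl⟩ : ∃ h : H, z = c.out * h := ⟨⟨_, hz⟩, by simp⟩
            simp only [LocallyConstant.coe_add, Pi.add_apply, extend_mul]
          · simp only [LocallyConstant.coe_add, Pi.add_apply, extend_of_notMem hH _ _ hz, add_zero]
         map_smul' := fun a f => by
          rw [RingHom.id_apply, ← map_smul]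
          congr 1
          ext z
          by_cases hz : c.out⁻¹ * z ∈ H
          · obtain ⟨h, rfl⟩ : ∃ h : H, z = c.out * h := ⟨⟨_, hz⟩, by simp⟩
            simp only [LocallyConstant.coe_smul, Pi.smul_apply, extend_mul]
          · simp only [LocallyConstant.coe_smul, Pi.smul_apply, extend_of_notMem hH _ _ hz,
              smul_zero] },
        (fun h : H => c.out * (h : G)) ⁻¹' C, by
          refine Topology.IsClosedEmbedding.isCompact_preimage ?_ hC
          exact (Homeomorph.mulLeft c.out).isClosedEmbedding.comp
            (H.isClosed_of_isOpen hH).isClosedEmbedding_subtypeVal, fun f hf => by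
          refine hx _ fun z hzC => ?_
          by_cases hz : c.out⁻¹ * z ∈ H
          · obtain ⟨h, rfl⟩ : ∃ h : H, z = c.out * h := ⟨⟨_, hz⟩, by simp⟩
            rw [extend_mul]
            exact hf h hzC
          · exact extend_of_notMem hH _ _ hz⟩
    have hy₀ : ∀ c f, toLin (y₀ c) f = toLin x (extend hH c.out f) := fun _ _ => rfl
    refine ⟨Finsupp.onFinset hfin.toFinset y₀ fun c hc => ?_, ext fun f => ?_⟩
    · rw [Set.Finite.mem_toFinset]
      by_contra hcC
      refine hc (ext fun f => ?_)
      rw [hy₀, map_zero, LinearMap.zero_apply]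
      refine hx _ fun z hzC => extend_of_notMem hH _ _ fun hz => hcC ⟨z, hzC, (mem_iff c z).1 hz⟩
    · rw [eval_sum, Finsupp.onFinset_sum _ (fun c => by simp)]
      simp only [hy₀, ← map_sum]
      refine toLin_congr x hx fun z hz => ?_
      rw [← LocallyConstant.evalₗ_apply k z (∑ _ ∈ _, _), map_sum,
        Finset.sum_eq_single (z : G ⧸ H)]
      · obtain ⟨h, hh⟩ : ∃ h : H, z = (z : G ⧸ H).out * h :=
          ⟨⟨_, (mem_iff (z : G ⧸ H) z).2 rfl⟩, by simp⟩
        exact (congrArg f hh).trans ((extend_mul hH _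
          ((translate (z : G ⧸ H).out f).comap ⟨Subtype.val, continuous_subtype_val⟩) h).symm.trans
            (congrArg _ hh.symm))
      · intro c _ hc
        exact extend_of_notMem hH _ _ fun h => hc ((mem_iff c z).1 h).symm
      · exact fun h => absurd (hfin.mem_toFinset.2 ⟨z, hz, rfl⟩) h
  · intro y y' hy hy'
    have key : ∀ y : (G ⧸ H) →₀ AugmentedIwasawaAlgebra k H,
        x = (y.sum fun c μ => dirac c.out * ofSubgroup H μ) →
        ∀ c f, toLin (y c) f = toLin x (extend hH c.out f) := by
      intro y hy c f
      rw [hy, eval_sum, Finsupp.sum, Finset.sum_eq_single c]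
      · congr 1
        ext h
        exact (extend_mul hH _ f h).symm
      · intro d _ hd
        rw [← map_zero (toLin (y d))]
        congr 1
        ext h
        refine extend_of_notMem hH _ _ fun hh => hd ?_
        have := (mem_iff c _).1 hh
        rw [← this, eq_comm, ← mem_iff]
        simp
      · intro hc
        rw [Finsupp.notMem_support_iff.1 hc, map_zero, LinearMap.zero_apply]
    exact Finsupp.ext fun c => ext fun f => (key y hy c f).trans (key y' hy' c f).symm

variable (k G) in
/-- The Iwasawa algebra of a profinite group as the inverse limit of the group algebras `k[G ⧸ N]`
over the open normal subgroups `N`. -/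
def completedGroupAlgebra :
    Subalgebra k (∀ N : OpenNormalSubgroup G, MonoidAlgebra k (G ⧸ N.toSubgroup)) where
  carrier := {a | ∀ (N M : OpenNormalSubgroup G) (h : N.toSubgroup ≤ M.toSubgroup),
    MonoidAlgebra.mapDomainAlgHom k k (QuotientGroup.map _ _ (MonoidHom.id G) h) (a N) = a M}
  mul_mem' ha hb N M h := by rw [Pi.mul_apply, map_mul, ha N M h, hb N M h, Pi.mul_apply]
  add_mem' ha hb N M h := by rw [Pi.add_apply, map_add, ha N M h, hb N M h, Pi.add_apply]
  algebraMap_mem' c N M h := by simp only [Pi.algebraMap_apply, AlgHom.commutes]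

/-- The function `φ` on `G ⧸ N`, viewed as a function on `G`. -/
def inflate (N : OpenNormalSubgroup G) : (G ⧸ N.toSubgroup → k) →ₗ[k] LocallyConstant G k where
  toFun φ :=
    { toFun := fun x => φ x
      isLocallyConstant := by
        have := QuotientGroup.discreteTopology N.isOpen'
        exact (IsLocallyConstant.of_discrete φ).comp_continuous QuotientGroup.continuous_mk }
  map_add' _ _ := rfl
  map_smul' _ _ := rfl

theorem inflate_apply (N : OpenNormalSubgroup G) (φ : G ⧸ N.toSubgroup → k) (x : G) :
    inflate N φ x = φ x := rfl

variable [CompactSpace G]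

instance (N : OpenNormalSubgroup G) : Finite (G ⧸ N.toSubgroup) :=
  Subgroup.quotient_finite_of_isOpen _ N.isOpen'

/-- The pairing of functions on a group with elements of the group algebra. -/
noncomputable def pairing {Q : Type*} (φ : Q → k) : MonoidAlgebra k Q →ₗ[k] k where
  toFun a := Finsupp.linearCombination k φ a.coeff
  map_add' a b := by rw [MonoidAlgebra.coeff_add, map_add]
  map_smul' r a := by rw [MonoidAlgebra.coeff_smul, map_smul, RingHom.id_apply]

theorem pairing_single {Q : Type*} (φ : Q → k) (c : Q) (r : k) :
    pairing φ (MonoidAlgebra.single c r) = r * φ c := by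
  show Finsupp.linearCombination k φ (MonoidAlgebra.single c r).coeff = _
  rw [MonoidAlgebra.coeff_single, Finsupp.linearCombination_single, smul_eq_mul]

theorem pairing_add {Q : Type*} (φ ψ : Q → k) (a : MonoidAlgebra k Q) :
    pairing (fun c => φ c + ψ c) a = pairing φ a + pairing ψ a := by
  induction a using MonoidAlgebra.induction_linear with
  | zero => simp only [map_zero, add_zero]
  | add a a' h h' => simp only [map_add, h, h', add_add_add_comm]
  | single x r => simp only [pairing_single, mul_add]

theorem pairing_smul {Q : Type*} (r : k) (φ : Q → k) (a : MonoidAlgebra k Q) :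
    pairing (fun c => r * φ c) a = r * pairing φ a := by
  induction a using MonoidAlgebra.induction_linear with
  | zero => simp only [map_zero, mul_zero]
  | add a a' h h' => simp only [map_add, h, h', mul_add]
  | single x s => simp only [pairing_single, mul_left_comm]

theorem pairing_mul {Q : Type*} [Group Q] (φ : Q → k) (a b : MonoidAlgebra k Q) :
    pairing φ (a * b) = pairing (fun x => pairing (fun y => φ (x * y)) b) a := by
  induction a using MonoidAlgebra.induction_linear with
  | zero => simp only [zero_mul, map_zero]
  | add a a' h h' => rw [add_mul, map_add, h, h', map_add]
  | single x r =>
    induction b using MonoidAlgebra.induction_linear with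
    | zero => simp only [mul_zero, map_zero, pairing_single]
    | add b b' h h' =>
      rw [mul_add, map_add, h, h', pairing_single, pairing_single, pairing_single, map_add, mul_add]
    | single y s => simp only [MonoidAlgebra.single_mul_single, pairing_single, mul_assoc]

theorem pairing_map {Q Q' : Type*} [Group Q] [Group Q'] (f : Q →* Q') (φ : Q' → k)
    (a : MonoidAlgebra k Q) :
    pairing φ (MonoidAlgebra.mapDomainAlgHom k k f a) = pairing (fun x => φ (f x)) a := by
  induction a using MonoidAlgebra.induction_linear with
  | zero => simp only [map_zero]
  | add a a' h h' => rw [map_add, map_add, h, h', map_add]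
  | single x r =>
    rw [MonoidAlgebra.mapDomainAlgHom_apply, MonoidAlgebra.mapDomain_single, pairing_single,
      pairing_single]

theorem pairing_ext {Q : Type*} {a b : MonoidAlgebra k Q}
    (h : ∀ φ : Q → k, pairing φ a = pairing φ b) : a = b := by
  classical
  have key : ∀ (x : MonoidAlgebra k Q) (c : Q), pairing (Pi.single c 1) x = x.coeff c := by
    intro x c
    induction x using MonoidAlgebra.induction_linear with
    | zero => simp
    | add a a' h h' => simp [h, h']
    | single y s => simp [pairing_single, Finsupp.single_apply, Pi.single_apply]
  exact MonoidAlgebra.coeff_injective (Finsupp.ext fun c => by rw [← key, ← key, h])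

open Classical in
/-- The map `kG → k[G ⧸ N]` for a compact group `G`. -/
noncomputable def toQuotient (N : OpenNormalSubgroup G) (μ : AugmentedIwasawaAlgebra k G) :
    MonoidAlgebra k (G ⧸ N.toSubgroup) :=
  letI := Fintype.ofFinite (G ⧸ N.toSubgroup)
  ∑ c, MonoidAlgebra.single c (toLin μ (inflate N (Pi.single c 1)))

theorem pairing_toQuotient (N : OpenNormalSubgroup G) (μ : AugmentedIwasawaAlgebra k G)
    (φ : G ⧸ N.toSubgroup → k) : pairing φ (toQuotient N μ) = toLin μ (inflate N φ) := by
  classical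
  let _ := Fintype.ofFinite (G ⧸ N.toSubgroup)
  have : φ = ∑ c, φ c • (Pi.single c 1 : G ⧸ N.toSubgroup → k) := by
    ext c
    simp [Finset.sum_apply, Pi.single_apply]
  conv_rhs => rw [this]
  rw [map_sum, map_sum, toQuotient, map_sum]
  refine Finset.sum_congr (by ext; simp) fun c _ => ?_
  rw [pairing_single, map_smul, map_smul, smul_eq_mul, mul_comm]

/-- For a profinite group `G`, `kG` is the usual Iwasawa algebra `lim k[G ⧸ N]`. -/
theorem exists_equiv_completedGroupAlgebra [TotallyDisconnectedSpace G] :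
    ∃ e : AugmentedIwasawaAlgebra k G ≃ₐ[k] completedGroupAlgebra k G,
      (∀ (g : G) (N : OpenNormalSubgroup G),
        (e (dirac g)).1 N = MonoidAlgebra.single (g : G ⧸ N.toSubgroup) 1) ∧
      ∀ (μ : AugmentedIwasawaAlgebra k G) (N : OpenNormalSubgroup G) (φ : G ⧸ N.toSubgroup → k),
        pairing φ ((e μ).1 N) = toLin μ (inflate N φ) := by
  have exists_inv : ∀ f : LocallyConstant G k, ∃ N : OpenNormalSubgroup G,
      ∀ x, ∀ n ∈ N.toSubgroup, f (x * n) = f x := by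
    intro f
    have : ∀ᶠ v in nhds (1 : G), ∀ x ∈ (Set.univ : Set G), f (x * v) = f x := by
      refine isCompact_univ.eventually_forall_of_forall_eventually fun x _ => ?_
      have h0 : f (x * 1) = f x := by rw [mul_one]
      have h1 : ∀ᶠ q : G × G in nhds (1, x), f (q.2 * q.1) = f (x * 1) :=
        ((continuous_snd.mul continuous_fst).tendsto (1, x)).eventually
          (f.isLocallyConstant.eventually_eq (x * 1))
      have h2 : ∀ᶠ q : G × G in nhds (1, x), f q.2 = f x :=
        (continuous_snd.tendsto ((1 : G), x)).eventually (f.isLocallyConstant.eventually_eq x)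
      filter_upwards [h1, h2] with q h1 h2 using h1.trans (h0.trans h2.symm)
    obtain ⟨U, hU, hUo, h1U⟩ := mem_nhds_iff.1 this
    obtain ⟨N, hN⟩ := ProfiniteGrp.exist_openNormalSubgroup_sub_open_nhds_of_one hUo h1U
    exact ⟨N, fun x n hn => hU (hN hn) x (Set.mem_univ x)⟩
  have desc : ∀ (f : LocallyConstant G k) (N : OpenNormalSubgroup G),
      (∀ x, ∀ n ∈ N.toSubgroup, f (x * n) = f x) →
      ∀ x : G, f (x : G ⧸ N.toSubgroup).out = f x := by
    intro f N hf x
    obtain ⟨n, hn⟩ := QuotientGroup.mk_out_eq_mul N.toSubgroup x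
    rw [hn]
    exact hf x n n.2
  let φ : AugmentedIwasawaAlgebra k G →ₐ[k] completedGroupAlgebra k G :=
    AlgHom.ofLinearMap
      { toFun := fun μ => ⟨fun N => toQuotient N μ, fun N M h => pairing_ext fun φ => by
          rw [pairing_map, pairing_toQuotient, pairing_toQuotient]
          rfl⟩
        map_add' := fun μ ν => Subtype.ext <| funext fun N => pairing_ext fun φ => by
          show pairing φ (toQuotient N (μ + ν)) = pairing φ (toQuotient N μ + toQuotient N ν)
          rw [map_add, pairing_toQuotient, pairing_toQuotient, pairing_toQuotient]
          rfl
        map_smul' := fun r μ => Subtype.ext <| funext fun N => pairing_ext fun φ => by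
          show pairing φ (toQuotient N (r • μ)) = pairing φ (r • toQuotient N μ)
          rw [map_smul, pairing_toQuotient, pairing_toQuotient]
          rfl }
      (Subtype.ext <| funext fun N => pairing_ext fun φ => by
        show pairing φ (toQuotient N 1) = pairing φ 1
        rw [pairing_toQuotient, MonoidAlgebra.one_def, pairing_single, one_mul]
        rfl)
      (fun μ ν => Subtype.ext <| funext fun N => pairing_ext fun φ => by
        show pairing φ (toQuotient N (μ * ν)) = pairing φ (toQuotient N μ * toQuotient N ν)
        rw [pairing_mul, pairing_toQuotient, pairing_toQuotient, toLin_mul]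
        congr 1
        ext x
        rw [inflate_apply, pairing_toQuotient]
        rfl)
  have hφ : ∀ μ N, (φ μ).1 N = toQuotient N μ := fun _ _ => rfl
  have hbij : Function.Bijective φ := by
    constructor
    · intro μ ν h
      refine ext fun f => ?_
      obtain ⟨N, hN⟩ := exists_inv f
      have : inflate N (fun c => f c.out) = f := LocallyConstant.ext (desc f N hN)
      rw [← this, ← pairing_toQuotient, ← pairing_toQuotient, ← hφ, ← hφ, h]
    · intro a
      have wd : ∀ (f : LocallyConstant G k) (N M : OpenNormalSubgroup G),
          (∀ x, ∀ n ∈ N.toSubgroup, f (x * n) = f x) → (∀ x, ∀ n ∈ M.toSubgroup, f (x * n) = f x) →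
          pairing (fun c => f c.out) (a.1 N) = pairing (fun c => f c.out) (a.1 M) := by
        have step : ∀ (f : LocallyConstant G k) (N M : OpenNormalSubgroup G),
            N.toSubgroup ≤ M.toSubgroup → (∀ x, ∀ n ∈ M.toSubgroup, f (x * n) = f x) →
            pairing (fun c => f c.out) (a.1 N) = pairing (fun c => f c.out) (a.1 M) := by
          intro f N M h hM
          rw [← a.2 N M h, pairing_map]
          refine congrArg (fun ψ => pairing ψ (a.1 N)) (funext fun c => ?_)
          induction c using QuotientGroup.induction_on with | H x => ?_
          exact (desc f N (fun x n hn => hM x n (h hn)) x).trans (desc f M hM x).symm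
        intro f N M hN hM
        have hle1 : (N ⊓ M).toSubgroup ≤ N.toSubgroup := inf_le_left
        have hle2 : (N ⊓ M).toSubgroup ≤ M.toSubgroup := inf_le_right
        rw [← step f (N ⊓ M) N hle1 hN, step f (N ⊓ M) M hle2 hM]
      choose S hS using exists_inv
      let L : LocallyConstant G k →ₗ[k] k :=
        { toFun := fun f => pairing (fun c => f c.out) (a.1 (S f))
          map_add' := fun f g => by
            have hf : ∀ x, ∀ n ∈ (S f ⊓ S g).toSubgroup, f (x * n) = f x :=
              fun x n hn => hS f x n hn.1
            have hg : ∀ x, ∀ n ∈ (S f ⊓ S g).toSubgroup, g (x * n) = g x :=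
              fun x n hn => hS g x n hn.2
            have hfg : ∀ x, ∀ n ∈ (S f ⊓ S g).toSubgroup, (f + g) (x * n) = (f + g) x :=
              fun x n hn => congrArg₂ (· + ·) (hf x n hn) (hg x n hn)
            rw [wd f _ _ (hS f) hf, wd g _ _ (hS g) hg, wd (f + g) _ _ (hS (f + g)) hfg]
            exact pairing_add _ _ _
          map_smul' := fun r f => by
            have hrf : ∀ x, ∀ n ∈ (S f).toSubgroup, (r • f) (x * n) = (r • f) x :=
              fun x n hn => congrArg (r • ·) (hS f x n hn)
            rw [wd (r • f) _ _ (hS (r • f)) hrf]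
            exact pairing_smul _ _ _ }
      refine ⟨⟨L, Set.univ, isCompact_univ, fun f hf => ?_⟩, Subtype.ext <| funext fun N =>
        pairing_ext fun ψ => ?_⟩
      · rw [show f = 0 from LocallyConstant.ext fun x => hf x (Set.mem_univ x), map_zero]
      · refine (pairing_toQuotient N _ ψ).trans ?_
        show pairing (fun c : G ⧸ (S (inflate N ψ)).toSubgroup => inflate N ψ c.out) _ = _
        rw [wd (inflate N ψ) _ N (hS _) (fun x n hn => by
          rw [inflate_apply, inflate_apply]
          congr 1
          exact QuotientGroup.mk_mul_of_mem x hn)]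
        refine congrArg (fun ψ => pairing ψ (a.1 N)) (funext fun c => ?_)
        rw [inflate_apply, QuotientGroup.out_eq']
  refine ⟨AlgEquiv.ofBijective φ hbij, fun g N => pairing_ext fun ψ => ?_,
    fun μ N ψ => pairing_toQuotient N μ ψ⟩
  show pairing ψ (toQuotient N (dirac g)) = _
  rw [pairing_toQuotient, pairing_single, one_mul]
  rfl

end AugmentedIwasawaAlgebra

end AugmentedIwasawa

section Coherence

variable (R : Type*) [Ring R]

/-- Every finitely generated left ideal is finitely presented. -/
def IsLeftCoherent : Prop :=
  ∀ I : Submodule R R, I.FG → Module.FinitePresentation R I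

/-- Every finitely generated right ideal is finitely presented. -/
def IsRightCoherent : Prop :=
  ∀ I : Submodule Rᵐᵒᵖ R, I.FG → Module.FinitePresentation Rᵐᵒᵖ I

end Coherence

section MatrixGroups

variable {F : Type*} [Field F]

/-- The additively written discrete valuation of a field with a `ℤᵐ⁰`-valued valuation `v`
(junk value `0` at `0`). -/
noncomputable def ordVal [Valued F ℤᵐ⁰] (x : F) : ℤ :=
  -WithZero.log (Valued.v x)

/-- The matrix with rows `(1, 0, a)`, `(0, 1, b)`, `(0, 0, 1)`. -/
def unip (a b : F) : GL (Fin 3) F where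
  val := !![1, 0, a; 0, 1, b; 0, 0, 1]
  inv := !![1, 0, -a; 0, 1, -b; 0, 0, 1]
  val_inv := by
    ext i j; fin_cases i <;> fin_cases j <;> simp [Matrix.mul_apply, Fin.sum_univ_succ]
  inv_val := by
    ext i j; fin_cases i <;> fin_cases j <;> simp [Matrix.mul_apply, Fin.sum_univ_succ]

theorem unip_mul (a b a' b' : F) : unip a b * unip a' b' = unip (a + a') (b + b') := by
  ext i j
  fin_cases i <;> fin_cases j <;> simp [unip, Matrix.mul_apply, Fin.sum_univ_succ, add_comm]

variable (F) in
/-- The group of upper unitriangular `3 × 3` matrices over `F` with `(1,2)`-entry zero. -/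
def unipSubgroup : Subgroup (GL (Fin 3) F) where
  carrier := {g | ∃ a b : F, g = unip a b}
  mul_mem' := by
    rintro _ _ ⟨a, b, rfl⟩ ⟨a', b', rfl⟩
    exact ⟨_, _, unip_mul a b a' b'⟩
  one_mem' := ⟨0, 0, by ext i j; fin_cases i <;> fin_cases j <;> simp [unip]⟩
  inv_mem' := by
    rintro _ ⟨a, b, rfl⟩
    exact ⟨-a, -b, Units.ext rfl⟩

/-- The diagonal matrix `diag(u, v, 1)`. -/
def diagElt (u v : Fˣ) : GL (Fin 3) F where
  val := Matrix.diagonal ![(u : F), v, 1]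
  inv := Matrix.diagonal ![((u⁻¹ : Fˣ) : F), ((v⁻¹ : Fˣ) : F), 1]
  val_inv := by
    rw [Matrix.diagonal_mul_diagonal, ← Matrix.diagonal_one]
    congr 1; ext i; fin_cases i <;> simp
  inv_val := by
    rw [Matrix.diagonal_mul_diagonal, ← Matrix.diagonal_one]
    congr 1; ext i; fin_cases i <;> simp

/-- The subgroup of `GL₃(F)` generated by `g` and the unitriangular matrices with `(1,2)`-entry
zero. It carries the subspace topology. -/
def groupG3 (g : GL (Fin 3) F) : Subgroup (GL (Fin 3) F) :=
  Subgroup.closure ({g} ∪ (unipSubgroup F : Set (GL (Fin 3) F)))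

/-- The generator `g` as an element of `groupG3 g`. -/
def groupG3.gen (g : GL (Fin 3) F) : groupG3 g :=
  ⟨g, Subgroup.subset_closure (Or.inl rfl)⟩

/-- The unitriangular matrices as elements of `groupG3 g`. -/
def groupG3.unip (g : GL (Fin 3) F) (a b : F) : groupG3 g :=
  ⟨_root_.unip a b, Subgroup.subset_closure (Or.inr ⟨a, b, rfl⟩)⟩

/-- `x` is a basis of the ring of integers of `F` as a `ℤ_p`-module. -/
def IsIntegralBasis (p : ℕ) [Fact p.Prime] [Valued F ℤᵐ⁰] [Algebra ℚ_[p] F] {n : ℕ}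
    (x : Fin n → F) : Prop :=
  LinearIndependent ℚ_[p] x ∧
    ∀ y : F, Valued.v y ≤ 1 ↔ ∃ c : Fin n → ℤ_[p], y = ∑ i, (c i : ℚ_[p]) • x i

open AugmentedIwasawaAlgebra in
/-- The left ideal of `k(groupG3 g)` generated by the elements `s_i = unip (x i) 0 - 1`,
`t_i = unip 0 (x i) - 1` and `g - 1`. -/
noncomputable def idealG3 (k : Type*) [Field k] [TopologicalSpace F] [IsTopologicalRing F]
    (g : GL (Fin 3) F) {n : ℕ} (x : Fin n → F) : Ideal (AugmentedIwasawaAlgebra k (groupG3 g)) :=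
  Ideal.span
    ((Set.range fun i => dirac (groupG3.unip g (x i) 0) - 1) ∪
      (Set.range fun i => dirac (groupG3.unip g 0 (x i)) - 1) ∪
      {dirac (groupG3.gen g) - 1})

end MatrixGroups

/-!
Write `g = diag(u, v, 1)` and let `G` be the group generated by `g` and `F²`, on which `g` acts by
contracting the first coordinate and expanding the second. For `i = 0, 1` let `Iᵢ` be the left ideal
of `kG` generated by `g - 1` and finitely many `h - 1`, with `h` unitriangular in the `i`-th
coordinate direction (`coordIdeal`). Both are finitely generated, so if `I₀ + I₁` is finitely
presented then `I₀ ∩ I₁` is finitely generated (`Submodule.fg_inf_of_finitePresentation_sup`). This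
is refuted in `not_fg_coordIdeal_inf`, as follows.

The group acts on `G / ⟨g⟩ = F²` by affine maps, and elements of `kG` push forward to distributions
on `F²`. An element of `Iᵢ` kills all functions on `F²` that are invariant under a sufficiently
large bounded subgroup of the `i`-th coordinate axis (`exists_vanishesAt_of_mem_coordIdeal`). Given
finitely many elements of `I₀ ∩ I₁`, there is one bound `γ` such that all of them kill the functions
invariant under translation by elements of valuation at most `γ` in either coordinate. This property
passes to the left ideal that they generate: left multiplication by `x ∈ G` transforms the function
by an affine map whose linear part is a power of `diag(u, v)`, which does not expand one of the two
coordinates, and invariance in that coordinate with the same bound `γ` is enough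
(`mem_boundedIdeal`). On the other hand, conjugating by powers of `g` shows that `I₀ ∩ I₁` contains
`(h - 1) * (h' - 1)` with `h` and `h'` translations of arbitrarily large size along the two axes
(`exists_large_mem_coordIdeal`), and such a product takes the value `1` on the indicator function of
a ball. The argument never uses the structure of the Iwasawa algebras of compact subgroups.

For right coherence, inversion on `G` identifies `kG` with its opposite ring. That it reverses
products is a Fubini theorem for compactly supported distributions
(`AugmentedIwasawaAlgebra.exists_toLin_mul_eq_swap`).
-/

/-! ### Finitely presented sums of submodules -/

/-- If a sum of two finitely generated submodules is finitely presented, then their intersection,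
which is the kernel of `N₁ × N₂ → N₁ ⊔ N₂` up to a sign, is finitely generated. -/
theorem Submodule.fg_inf_of_finitePresentation_sup {R M : Type*} [Ring R] [AddCommGroup M]
    [Module R M] {N₁ N₂ : Submodule R M} (h₁ : N₁.FG) (h₂ : N₂.FG)
    (h : Module.FinitePresentation R ↥(N₁ ⊔ N₂)) : (N₁ ⊓ N₂).FG := by
  have := Module.Finite.iff_fg.2 h₁
  have := Module.Finite.iff_fg.2 h₂
  let l : (N₁ × N₂) →ₗ[R] ↥(N₁ ⊔ N₂) :=
    (Submodule.inclusion le_sup_left).coprod (Submodule.inclusion le_sup_right)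
  have hl : ∀ z, (l z : M) = z.1 + z.2 := fun _ => rfl
  have hsurj : Function.Surjective l := by
    rintro ⟨z, hz⟩
    obtain ⟨a, ha, b, hb, rfl⟩ := Submodule.mem_sup.1 hz
    exact ⟨(⟨a, ha⟩, ⟨b, hb⟩), rfl⟩
  convert (Module.FinitePresentation.fg_ker l hsurj).map (N₁.subtype ∘ₗ LinearMap.fst R N₁ N₂)
  ext z
  constructor
  · rintro ⟨hz₁, hz₂⟩
    refine ⟨(⟨z, hz₁⟩, -⟨z, hz₂⟩), ?_, rfl⟩
    exact Subtype.ext ((hl _).trans (add_neg_cancel z))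
  · rintro ⟨⟨a, b⟩, hab, rfl⟩
    have h0 : (a : M) + b = 0 := (hl (a, b)).symm.trans (congrArg Subtype.val hab)
    have h1 : (a : M) = -b := eq_neg_of_add_eq_zero_left h0
    exact ⟨a.2, show (a : M) ∈ N₂ from h1 ▸ N₂.neg_mem b.2⟩

/-! ### Inversion on the augmented Iwasawa algebra -/

namespace AugmentedIwasawaAlgebra

variable {k : Type*} [Field k] {G : Type*} [TopologicalSpace G] [Group G] [IsTopologicalGroup G]

/-- A Fubini theorem: `(μ * ν) f` is also the value of `ν` at the function `y ↦ μ (x ↦ f (x * y))`,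
or rather at a locally constant function `φ` that agrees with it on a compact set `D` carrying `ν`.
As `x` runs through a compact set carrying `μ`, the restriction of `y ↦ f (x * y)` to `D` takes
only finitely many values, so that `(x, y) ↦ f (x * y)` may be replaced by a finite sum of products
of functions of one variable. -/
theorem exists_toLin_mul_eq_swap (μ ν : AugmentedIwasawaAlgebra k G) (f : LocallyConstant G k) :
    ∃ φ : LocallyConstant G k, (∃ D : Set G, IsCompact D ∧
      (∀ h : LocallyConstant G k, (∀ y ∈ D, h y = 0) → toLin ν h = 0) ∧
      ∀ y ∈ D, φ y = toLin μ (f.comap ⟨fun x => x * y, continuous_mul_const y⟩)) ∧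
      toLin (μ * ν) f = toLin ν φ := by
  classical
  obtain ⟨C, hC, hμ⟩ := μ.exists_compact
  obtain ⟨D, hD, hν⟩ := ν.exists_compact
  let θ : G → D → k := fun x y => f (x * y)
  have hθ : IsLocallyConstant θ := by
    rw [IsLocallyConstant.iff_eventually_eq]
    intro x
    have : ∀ᶠ x' in nhds x, ∀ y ∈ D, f (x' * y) = f (x * y) := by
      refine hD.eventually_forall_of_forall_eventually fun y _ => ?_
      have h1 : ∀ᶠ q : G × G in nhds (x, y), f (q.1 * q.2) = f (x * y) :=
        (continuous_mul.tendsto (x, y)).eventually (f.isLocallyConstant.eventually_eq (x * y))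
      have h2 : ∀ᶠ q : G × G in nhds (x, y), f (x * q.2) = f (x * y) :=
        ((continuous_const.mul continuous_snd).tendsto (x, y)).eventually
          (f.isLocallyConstant.eventually_eq (x * y))
      filter_upwards [h1, h2] with q h1 h2 using h1.trans h2.symm
    filter_upwards [this] with x' hx'
    exact funext fun y => hx' y y.2
  have hfin : (θ '' C).Finite := by
    let _ : TopologicalSpace (D → k) := ⊥
    have : DiscreteTopology (D → k) := ⟨rfl⟩
    exact (hC.image hθ.continuous).finite_of_discrete
  choose r hr using fun t : hfin.toFinset => hfin.mem_toFinset.1 t.2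
  let e : hfin.toFinset → LocallyConstant G k := fun t =>
    ⟨fun x => if θ x = t then 1 else 0, hθ.comp fun s => if s = t.1 then 1 else 0⟩
  have he : ∀ t x, e t x = if θ x = t then 1 else 0 := fun _ _ => rfl
  have key : ∀ x ∈ C, ∀ y ∈ D, f (x * y) = ∑ t, e t x * f (r t * y) := by
    intro x hx y hy
    have hmem : θ x ∈ hfin.toFinset := hfin.mem_toFinset.2 ⟨x, hx, rfl⟩
    rw [Finset.sum_eq_single (⟨θ x, hmem⟩ : hfin.toFinset)]
    · rw [he, if_pos rfl, one_mul]
      exact (congrFun (hr ⟨θ x, hmem⟩).2 ⟨y, hy⟩).symm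
    · intro t _ ht
      rw [he, if_neg fun h => ht (Subtype.ext h.symm), zero_mul]
    · exact fun h => absurd (Finset.mem_univ _) h
  have sum_apply : ∀ (c : hfin.toFinset → k) (h : hfin.toFinset → LocallyConstant G k) (x : G),
      (∑ t, c t • h t) x = ∑ t, c t * h t x := by
    intro c h x
    rw [← LocallyConstant.evalₗ_apply k x, map_sum]
    rfl
  refine ⟨∑ t, toLin μ (e t) • translate (r t) f, ⟨D, hD, hν, fun y hy => ?_⟩, ?_⟩
  · rw [sum_apply, toLin_congr μ hμ (f' := ∑ t, f (r t * y) • e t)]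
    · rw [map_sum]
      exact Finset.sum_congr rfl fun t _ => by rw [map_smul, smul_eq_mul, mul_comm]; rfl
    · intro x hx
      rw [sum_apply]
      exact (key x hx y hy).trans (Finset.sum_congr rfl fun t _ => mul_comm _ _)
  · rw [toLin_mul, toLin_congr μ hμ (f' := ∑ t, toLin ν (translate (r t) f) • e t)]
    · simp only [map_sum, map_smul, smul_eq_mul]
      exact Finset.sum_congr rfl fun t _ => mul_comm _ _
    · intro x hx
      rw [sum_apply, convolve_apply,
        toLin_congr ν hν (f' := ∑ t, e t x • translate (r t) f)]
      · rw [map_sum]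
        exact Finset.sum_congr rfl fun t _ => by rw [map_smul, smul_eq_mul, mul_comm]
      · intro y hy
        rw [sum_apply]
        exact key x hx y hy

/-- The push-forward of distributions along `x ↦ x⁻¹`. -/
noncomputable def invFun (μ : AugmentedIwasawaAlgebra k G) : AugmentedIwasawaAlgebra k G :=
  ⟨toLin μ ∘ₗ LocallyConstant.comapₗ k ⟨fun x : G => x⁻¹, continuous_inv⟩, by
    obtain ⟨C, hC, hμ⟩ := μ.exists_compact
    exact ⟨(fun x => x⁻¹) '' C, hC.image continuous_inv, fun f hf => hμ _ fun x hx =>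
      hf _ ⟨x, hx, rfl⟩⟩⟩

theorem toLin_invFun (μ : AugmentedIwasawaAlgebra k G) (f : LocallyConstant G k) :
    toLin (invFun μ) f = toLin μ (f.comap ⟨fun x => x⁻¹, continuous_inv⟩) := rfl

theorem invFun_invFun (μ : AugmentedIwasawaAlgebra k G) : invFun (invFun μ) = μ :=
  ext fun f => by
    rw [toLin_invFun, toLin_invFun]
    congr 1
    ext x
    exact congrArg f (inv_inv x)

theorem invFun_mul (μ ν : AugmentedIwasawaAlgebra k G) :
    invFun (μ * ν) = invFun ν * invFun μ :=
  ext fun f => by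
    obtain ⟨φ, ⟨D, -, hν, hφ⟩, h⟩ :=
      exists_toLin_mul_eq_swap μ ν (f.comap ⟨fun x => x⁻¹, continuous_inv⟩)
    rw [toLin_invFun, h, toLin_mul, toLin_invFun]
    refine toLin_congr ν hν fun y hy => (hφ y hy).trans ?_
    show _ = toLin (invFun μ) (translate y⁻¹ f)
    rw [toLin_invFun]
    congr 1
    ext x
    exact congrArg f (mul_inv_rev x y)

variable (k G) in
/-- The isomorphism of `kG` with its opposite ring induced by inversion on `G`. -/
noncomputable def opEquiv : AugmentedIwasawaAlgebra k G ≃+* (AugmentedIwasawaAlgebra k G)ᵐᵒᵖ where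
  toFun μ := MulOpposite.op (invFun μ)
  invFun μ := AugmentedIwasawaAlgebra.invFun μ.unop
  left_inv μ := invFun_invFun μ
  right_inv μ := congrArg MulOpposite.op (invFun_invFun μ.unop)
  map_mul' μ ν := congrArg MulOpposite.op (invFun_mul μ ν)
  map_add' _ _ := rfl

end AugmentedIwasawaAlgebra

/-! ### Coherence of opposite rings -/

/-- A ring isomorphic to its opposite that has two finitely generated left ideals whose
intersection is not finitely generated is not right coherent. -/
theorem not_isRightCoherent_of_not_fg_inf {R : Type*} [Ring R] (e : R ≃+* Rᵐᵒᵖ)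
    {I J : Submodule R R} (hI : I.FG) (hJ : J.FG) (hIJ : ¬ (I ⊓ J).FG) :
    ¬ IsRightCoherent R := by
  intro h
  have : RingHomInvPair (e : R →+* Rᵐᵒᵖ) e.symm := RingHomInvPair.of_ringEquiv e
  have : RingHomInvPair (e.symm : Rᵐᵒᵖ →+* R) e := RingHomInvPair.of_ringEquiv e.symm
  let τ : R ≃ₛₗ[(e : R →+* Rᵐᵒᵖ)] R :=
    { e.toAddEquiv.trans MulOpposite.opAddEquiv.symm with
      map_smul' := fun r x => congrArg MulOpposite.unop (map_mul e r x) }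
  have hinf := Submodule.fg_inf_of_finitePresentation_sup (hI.map τ.toLinearMap)
    (hJ.map τ.toLinearMap) (h _ ((hI.map _).sup (hJ.map _)))
  rw [← Submodule.map_inf _ τ.injective] at hinf
  exact hIJ (Submodule.fg_of_fg_map_injective _ τ.injective hinf)

/-! ### Bounded sets of a valued field -/

section Valued

variable {F : Type*} [Field F] [Valued F ℤᵐ⁰]

theorem Valued.isClopen_setOf_le (c : Fˣ) :
    IsClopen {x : F | Valued.v x ≤ Valued.v (c : F)} := by
  have hc : (0 : ℤᵐ⁰) < Valued.v (c : F) := zero_lt_iff.2 ((Valuation.ne_zero_iff _).2 c.ne_zero)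
  have h := (Valued.isClopen_integer F).preimage
    (continuous_const_mul ((c⁻¹ : Fˣ) : F))
  convert h using 1
  ext x
  show _ ↔ Valued.v (((c⁻¹ : Fˣ) : F) * x) ≤ 1
  rw [map_mul, Units.val_inv_eq_inv_val, map_inv₀, inv_mul_le_iff₀ hc, mul_one]
  rfl

theorem Valued.exists_forall_le_of_isCompact {C : Set F} (hC : IsCompact C) :
    ∃ γ : ℤᵐ⁰, ∀ x ∈ C, Valued.v x ≤ γ := by
  obtain ⟨c, hc⟩ := hC.elim_directed_cover (fun c : Fˣ => {x : F | Valued.v x ≤ Valued.v (c : F)})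
    (fun c => (Valued.isClopen_setOf_le c).isOpen)
    (fun x _ => Set.mem_iUnion.2 (by
      by_cases hx : x = 0
      · exact ⟨1, by simp [hx]⟩
      · exact ⟨Units.mk0 x hx, le_refl (Valued.v x)⟩))
    (fun c d => by
      rcases le_total (Valued.v (c : F)) (Valued.v (d : F)) with h | h
      · exact ⟨d, fun x hx => le_trans hx h, fun x hx => hx⟩
      · exact ⟨c, fun x hx => hx, fun x hx => le_trans hx h⟩)
  exact ⟨_, hc⟩

/-- Powers of an element of valuation different from `1` have unbounded valuation. -/
theorem Valued.exists_zpow_mul_gt {u : Fˣ} (hu : Valued.v (u : F) ≠ 1) {x : F} (hx : x ≠ 0)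
    (γ : ℤᵐ⁰) : ∃ l : ℤ, γ < Valued.v (((u ^ l : Fˣ) : F) * x) := by
  have key : ∀ w : Fˣ, Valued.v (w : F) < 1 →
      ∃ n : ℕ, γ < Valued.v (((w ^ (-n : ℤ) : Fˣ) : F) * x) := by
    intro w hw
    have hw0 : (0 : ℤᵐ⁰) < Valued.v (w : F) := zero_lt_iff.2 ((Valuation.ne_zero_iff _).2 w.ne_zero)
    have hx0 : (0 : ℤᵐ⁰) < Valued.v x := zero_lt_iff.2 ((Valuation.ne_zero_iff _).2 hx)
    rcases eq_or_ne γ 0 with rfl | hγ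
    · exact ⟨0, by simpa using hx0⟩
    obtain ⟨n, hn⟩ := exists_pow_lt₀ hw
      (Units.mk0 (Valued.v x * γ⁻¹) (mul_ne_zero hx0.ne' (inv_ne_zero hγ)))
    refine ⟨n, ?_⟩
    rw [zpow_neg, zpow_natCast, map_mul, Units.val_inv_eq_inv_val, map_inv₀, Units.val_pow_eq_pow_val,
      map_pow, lt_inv_mul_iff₀ (pow_pos hw0 n)]
    rwa [Units.val_mk0, lt_mul_inv_iff₀ (zero_lt_iff.2 hγ)] at hn
  rcases lt_or_gt_of_ne hu with h | h
  · obtain ⟨n, hn⟩ := key u h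
    exact ⟨_, hn⟩
  · obtain ⟨n, hn⟩ := key u⁻¹ (by
      rw [Units.val_inv_eq_inv_val, map_inv₀]
      exact inv_lt_one_of_one_lt₀ h)
    exact ⟨n, by simpa using hn⟩

end Valued

/-! ### The group `F² ⋊ ℤ` and its affine action on `F²` -/

section Group

variable {F : Type*} [Field F]

theorem diagElt_mul (u v u' v' : Fˣ) : diagElt u v * diagElt u' v' = diagElt (u * u') (v * v') := by
  refine Units.ext ?_
  ext i j
  fin_cases i <;> fin_cases j <;> simp [diagElt]

theorem diagElt_zpow (u v : Fˣ) (l : ℤ) : diagElt u v ^ l = diagElt (u ^ l) (v ^ l) := by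
  have h1 : diagElt (1 : Fˣ) 1 = 1 := by
    refine Units.ext ?_
    ext i j
    fin_cases i <;> fin_cases j <;> simp [diagElt]
  let φ : Fˣ × Fˣ →* GL (Fin 3) F :=
    { toFun := fun w => diagElt w.1 w.2
      map_one' := h1
      map_mul' := fun w w' => (diagElt_mul _ _ _ _).symm }
  exact (map_zpow φ (u, v) l).symm

theorem diagElt_mul_unip (u v : Fˣ) (a b : F) :
    diagElt u v * unip a b = unip (u * a) (v * b) * diagElt u v := by
  refine Units.ext ?_
  ext i j
  fin_cases i <;> fin_cases j <;>
    simp [diagElt, unip, Matrix.mul_apply, Matrix.diagonal]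

theorem unip_inv (a b : F) : (unip a b)⁻¹ = unip (-a) (-b) := Units.ext rfl

theorem unip_mul_diagElt (u v : Fˣ) (a b : F) :
    ((unip a b * diagElt u v : GL (Fin 3) F) : Matrix (Fin 3) (Fin 3) F) =
      !![(u : F), 0, a; 0, v, b; 0, 0, 1] := by
  ext i j
  fin_cases i <;> fin_cases j <;>
    simp [diagElt, unip, Matrix.mul_apply, Matrix.diagonal]

/-- Elements of `groupG3 (diagElt u v)` are products of a unitriangular matrix and a power of
`diagElt u v`. -/
theorem groupG3.exists_eq {u v : Fˣ} (x : groupG3 (diagElt u v)) :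
    ∃ (a b : F) (l : ℤ), (x : GL (Fin 3) F) = _root_.unip a b * diagElt u v ^ l := by
  have h0 : (_root_.unip 0 0 : GL (Fin 3) F) = 1 := by
    refine Units.ext ?_
    ext i j
    fin_cases i <;> fin_cases j <;> simp [_root_.unip]
  obtain ⟨x, hx⟩ := x
  induction hx using Subgroup.closure_induction with
  | mem x hx =>
    rcases hx with rfl | ⟨a, b, rfl⟩
    · exact ⟨0, 0, 1, by rw [h0, one_mul, zpow_one]⟩
    · exact ⟨a, b, 0, by rw [zpow_zero, mul_one]⟩
  | one => exact ⟨0, 0, 0, by rw [h0, zpow_zero, mul_one]⟩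
  | mul x y _ _ hx hy =>
    obtain ⟨a, b, l, hx⟩ := hx
    obtain ⟨a', b', l', hy⟩ := hy
    refine ⟨a + (u ^ l : Fˣ) * a', b + (v ^ l : Fˣ) * b', l + l',
      (congrArg₂ (· * ·) hx hy).trans ?_⟩
    rw [zpow_add, ← mul_assoc, ← mul_assoc, ← unip_mul a b, mul_assoc (_root_.unip a b),
      diagElt_zpow u v l, diagElt_mul_unip]
    simp only [mul_assoc]
  | inv x _ hx =>
    obtain ⟨a, b, l, hx⟩ := hx
    refine ⟨(u ^ (-l) : Fˣ) * -a, (v ^ (-l) : Fˣ) * -b, -l, (congrArg (·⁻¹) hx).trans ?_⟩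
    rw [mul_inv_rev, unip_inv, ← zpow_neg, diagElt_zpow, diagElt_mul_unip]

/-- The first two entries of the last column. They identify the quotient of
`groupG3 (diagElt u v)` by the powers of `diagElt u v` with `F²`. -/
def groupG3.coord [TopologicalSpace F] (g : GL (Fin 3) F) : C(groupG3 g, Fin 2 → F) where
  toFun x i := (x : GL (Fin 3) F) i.castSucc 2
  continuous_toFun := continuous_pi fun _ =>
    (Units.continuous_val.comp continuous_subtype_val).matrix_elem _ _

/-- The first two diagonal entries. -/
def groupG3.diag [TopologicalSpace F] (g : GL (Fin 3) F) : C(groupG3 g, Fin 2 → F) where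
  toFun x i := (x : GL (Fin 3) F) i.castSucc i.castSucc
  continuous_toFun := continuous_pi fun _ =>
    (Units.continuous_val.comp continuous_subtype_val).matrix_elem _ _

/-- The unitriangular matrix with last column `(a₀, a₁, 1)`. -/
def groupG3.unip₂ (g : GL (Fin 3) F) (a : Fin 2 → F) : groupG3 g := groupG3.unip g (a 0) (a 1)

theorem groupG3.unip₂_mul (g : GL (Fin 3) F) (a b : Fin 2 → F) :
    unip₂ g a * unip₂ g b = unip₂ g (a + b) :=
  Subtype.ext (unip_mul _ _ _ _)

theorem groupG3.gen_zpow_mul_unip₂ {u v : Fˣ} (l : ℤ) (a : Fin 2 → F) :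
    gen (diagElt u v) ^ l * unip₂ (diagElt u v) a =
      unip₂ (diagElt u v) (fun i => ((![u, v] i ^ l : Fˣ) : F) * a i) * gen (diagElt u v) ^ l := by
  refine Subtype.ext ?_
  show diagElt u v ^ l * _root_.unip _ _ = _root_.unip _ _ * diagElt u v ^ l
  rw [diagElt_zpow, diagElt_mul_unip]
  rfl

variable [TopologicalSpace F]

theorem groupG3.coord_unip₂ (g : GL (Fin 3) F) (a : Fin 2 → F) : coord g (unip₂ g a) = a := by
  ext i
  fin_cases i <;> rfl

theorem groupG3.coord_one (g : GL (Fin 3) F) : coord g 1 = 0 := by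
  ext i
  fin_cases i <;> rfl

theorem groupG3.coord_gen (u v : Fˣ) : coord (diagElt u v) (gen (diagElt u v)) = 0 := by
  ext i
  fin_cases i <;> rfl

theorem groupG3.exists_diag_eq {u v : Fˣ} (x : groupG3 (diagElt u v)) :
    ∃ l : ℤ, ∀ i, diag (diagElt u v) x i = ((![u, v] i ^ l : Fˣ) : F) := by
  obtain ⟨a, b, l, hx⟩ := exists_eq x
  refine ⟨l, fun i => ?_⟩
  show (x : GL (Fin 3) F) i.castSucc i.castSucc = _
  rw [hx, diagElt_zpow, unip_mul_diagElt]
  fin_cases i <;> rfl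

/-- The affine action of the group on `F²`. -/
theorem groupG3.coord_mul {u v : Fˣ} (x y : groupG3 (diagElt u v)) :
    coord (diagElt u v) (x * y) =
      coord (diagElt u v) x + diag (diagElt u v) x * coord (diagElt u v) y := by
  obtain ⟨a, b, l, hx⟩ := exists_eq x
  obtain ⟨a', b', l', hy⟩ := exists_eq y
  ext i
  show ((x : GL (Fin 3) F) * (y : GL (Fin 3) F) : Matrix (Fin 3) (Fin 3) F) i.castSucc 2 =
    (x : GL (Fin 3) F) i.castSucc 2 +
    (x : GL (Fin 3) F) i.castSucc i.castSucc * (y : GL (Fin 3) F) i.castSucc 2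
  rw [hx, hy, diagElt_zpow, diagElt_zpow, unip_mul_diagElt, unip_mul_diagElt, Matrix.mul_apply,
    Fin.sum_univ_three]
  fin_cases i <;> simp [add_comm]

end Group

/-! ### Invariant functions on `F²` and the distributions they detect -/

section Obstruction

open AugmentedIwasawaAlgebra groupG3

variable {k : Type*} {F : Type*} [Field F] [Valued F ℤᵐ⁰]

/-- Invariance under translation of the `i`-th coordinate by the elements of valuation at
most `γ`. -/
def InvariantAt (i : Fin 2) (γ : ℤᵐ⁰) (f : LocallyConstant (Fin 2 → F) k) : Prop :=
  ∀ (a : Fin 2 → F) (w : F), Valued.v w ≤ γ → f (a + Pi.single i w) = f a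

/-- The function `a ↦ f (x • a)` for the affine action of the group on `F²`. -/
def affineTranslate {g : GL (Fin 3) F} (x : groupG3 g) (f : LocallyConstant (Fin 2 → F) k) :
    LocallyConstant (Fin 2 → F) k :=
  f.comap ⟨fun a => coord g x + diag g x * a, by fun_prop⟩

variable {u v : Fˣ}

theorem translate_comap_coord (x : groupG3 (diagElt u v)) (f : LocallyConstant (Fin 2 → F) k) :
    translate x (f.comap (coord (diagElt u v))) =
      (affineTranslate x f).comap (coord (diagElt u v)) :=
  LocallyConstant.ext fun y => congrArg f (coord_mul x y)

/-- Translating by `x` scales the `i`-th coordinate by the `i`-th diagonal entry of `x`. -/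
theorem InvariantAt.affineTranslate {g : GL (Fin 3) F} {i : Fin 2} {γ δ : ℤᵐ⁰}
    {f : LocallyConstant (Fin 2 → F) k} (hf : InvariantAt i δ f) (x : groupG3 g)
    (hx : Valued.v (diag g x i) * γ ≤ δ) : InvariantAt i γ (affineTranslate x f) := by
  intro a w hw
  show f (coord g x + diag g x * (a + Pi.single i w)) = f (coord g x + diag g x * a)
  have h : diag g x * Pi.single i w = Pi.single i (diag g x i * w) := by
    ext j
    by_cases hj : j = i
    · subst hj; simp
    · simp [hj]
  rw [mul_add, ← add_assoc, h]
  refine hf _ _ ?_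
  rw [map_mul]
  exact (mul_le_mul_right hw _).trans hx

variable [Field k]

/-- The distribution `μ`, pushed forward to `F²`, is zero on the functions that are invariant under
translation of the `i`-th coordinate by the elements of valuation at most `γ`. -/
def VanishesAt (g : GL (Fin 3) F) (i : Fin 2) (γ : ℤᵐ⁰)
    (μ : AugmentedIwasawaAlgebra k (groupG3 g)) : Prop :=
  ∀ f : LocallyConstant (Fin 2 → F) k, InvariantAt i γ f → toLin μ (f.comap (coord g)) = 0

theorem VanishesAt.mono {g : GL (Fin 3) F} {i : Fin 2} {γ δ : ℤᵐ⁰}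
    {μ : AugmentedIwasawaAlgebra k (groupG3 g)} (hμ : VanishesAt g i γ μ) (h : γ ≤ δ) :
    VanishesAt g i δ μ :=
  fun f hf => hμ f fun a w hw => hf a w (hw.trans h)

/-- The conjugates of a bounded subgroup of `F²` by the elements of a compact set are contained in
a common bounded subgroup. -/
theorem VanishesAt.exists_mul {i : Fin 2} {γ : ℤᵐ⁰}
    {μ : AugmentedIwasawaAlgebra k (groupG3 (diagElt u v))}
    (hμ : VanishesAt (diagElt u v) i γ μ)
    (ρ : AugmentedIwasawaAlgebra k (groupG3 (diagElt u v))) :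
    ∃ δ, VanishesAt (diagElt u v) i δ (ρ * μ) := by
  obtain ⟨C, hC, hρ⟩ := ρ.exists_compact
  obtain ⟨γ', hγ'⟩ := Valued.exists_forall_le_of_isCompact
    (hC.image ((continuous_apply i).comp (diag (diagElt u v)).continuous))
  refine ⟨γ' * γ, fun f hf => ?_⟩
  rw [toLin_mul]
  refine hρ _ fun x hx => ?_
  rw [convolve_apply, translate_comap_coord]
  exact hμ _ (hf.affineTranslate x (mul_le_mul_left (hγ' _ ⟨x, hx, rfl⟩) _))

/-- The left ideal of `k(groupG3 g)` generated by `g - 1` and the elements `h - 1`, where `h` is a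
unitriangular matrix whose last column is `x j` times the `i`-th basis vector. -/
noncomputable def coordIdeal (k : Type*) [Field k] (g : GL (Fin 3) F) (i : Fin 2) {n : ℕ}
    (x : Fin n → F) : Ideal (AugmentedIwasawaAlgebra k (groupG3 g)) :=
  Ideal.span ((Set.range fun j => dirac (unip₂ g (Pi.single i (x j))) - 1) ∪ {dirac (gen g) - 1})

theorem coordIdeal_fg (g : GL (Fin 3) F) (i : Fin 2) {n : ℕ} (x : Fin n → F) :
    (coordIdeal k g i x).FG :=
  Submodule.fg_span ((Set.finite_range _).union (Set.finite_singleton _))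

theorem exists_vanishesAt_of_mem_coordIdeal {i : Fin 2} {n : ℕ} {x : Fin n → F}
    {μ : AugmentedIwasawaAlgebra k (groupG3 (diagElt u v))}
    (hμ : μ ∈ coordIdeal k (diagElt u v) i x) :
    ∃ γ, VanishesAt (diagElt u v) i γ μ := by
  induction hμ using Submodule.span_induction with
  | mem μ hμ =>
    rcases hμ with ⟨j, rfl⟩ | rfl
    · refine ⟨Valued.v (x j), fun f hf => ?_⟩
      rw [map_sub, LinearMap.sub_apply, sub_eq_zero]
      show f (coord _ (unip₂ _ _)) = f (coord _ 1)
      rw [coord_unip₂, coord_one, ← hf 0 _ le_rfl, zero_add]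
    · refine ⟨0, fun f _ => ?_⟩
      rw [map_sub, LinearMap.sub_apply, sub_eq_zero]
      show f (coord _ (gen _)) = f (coord _ 1)
      rw [coord_gen, coord_one]
  | zero => exact ⟨0, fun f _ => rfl⟩
  | add μ ν _ _ hμ hν =>
    obtain ⟨γ, hγ⟩ := hμ
    obtain ⟨δ, hδ⟩ := hν
    refine ⟨max γ δ, fun f hf => ?_⟩
    rw [map_add, LinearMap.add_apply, hγ.mono (le_max_left _ _) f hf,
      hδ.mono (le_max_right _ _) f hf, add_zero]
  | smul ρ μ _ hμ =>
    obtain ⟨γ, hγ⟩ := hμ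
    exact hγ.exists_mul ρ

/-- The left ideal of the distributions that vanish on all left translates of the functions pulled
back from `F²` that are invariant, in both coordinates, under the elements of valuation at
most `γ`. -/
def boundedIdeal (k : Type*) [Field k] (g : GL (Fin 3) F) (γ : ℤᵐ⁰) :
    Ideal (AugmentedIwasawaAlgebra k (groupG3 g)) where
  carrier := {μ | ∀ f : LocallyConstant (Fin 2 → F) k, (∀ i, InvariantAt i γ f) →
    ∀ x, toLin μ (translate x (f.comap (coord g))) = 0}
  zero_mem' _ _ _ := rfl
  add_mem' hμ hν f hf x := by
    rw [map_add, LinearMap.add_apply, hμ f hf x, hν f hf x, add_zero]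
  smul_mem' ρ μ hμ f hf x := by
    rw [smul_eq_mul, toLin_mul, ← map_zero (toLin ρ)]
    refine congrArg (toLin ρ) (LocallyConstant.ext fun y => ?_)
    rw [convolve_apply, LocallyConstant.zero_apply, ← hμ f hf (x * y)]
    refine congrArg (toLin μ) (LocallyConstant.ext fun z => ?_)
    exact congrArg (fun w => f (coord g w)) (mul_assoc x y z).symm

/-- Every element of the group acts on one of the two coordinates without expanding it, since its first
two diagonal entries are `u ^ l` and `v ^ l` for a common exponent `l`. -/
theorem mem_boundedIdeal (hu : Valued.v (u : F) < 1) (hv : 1 < Valued.v (v : F)) {γ : ℤᵐ⁰}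
    {μ : AugmentedIwasawaAlgebra k (groupG3 (diagElt u v))}
    (hμ : ∀ i, VanishesAt (diagElt u v) i γ μ) : μ ∈ boundedIdeal k (diagElt u v) γ := by
  intro f hf x
  rw [translate_comap_coord]
  have hle : ∃ i, Valued.v (diag (diagElt u v) x i) ≤ 1 := by
    obtain ⟨l, hl⟩ := exists_diag_eq x
    rcases le_total 0 l with h | h
    · refine ⟨0, ?_⟩
      lift l to ℕ using h
      rw [hl, zpow_natCast, Units.val_pow_eq_pow_val, map_pow]
      exact pow_le_one' hu.le l
    · refine ⟨1, ?_⟩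
      obtain ⟨n, rfl⟩ := Int.exists_eq_neg_ofNat h
      rw [hl, zpow_neg, zpow_natCast, Units.val_inv_eq_inv_val, map_inv₀,
        Units.val_pow_eq_pow_val, map_pow]
      exact inv_le_one_of_one_le₀ (one_le_pow_of_one_le' hv.le n)
  obtain ⟨i, hi⟩ := hle
  exact hμ i _ ((hf i).affineTranslate x (mul_le_of_le_one_left' hi))

/-- The subgroup of the `y` with `dirac y - 1 ∈ I`, for a left ideal `I`. -/
def unitSubgroup {G : Type*} [TopologicalSpace G] [Group G] [IsTopologicalGroup G]
    (I : Ideal (AugmentedIwasawaAlgebra k G)) : Subgroup G where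
  carrier := {y | dirac y - 1 ∈ I}
  one_mem' := by
    show (1 : AugmentedIwasawaAlgebra k G) - 1 ∈ I
    rw [sub_self]
    exact I.zero_mem
  mul_mem' {y z} hy hz := by
    have := I.add_mem (I.mul_mem_left (dirac y) hz) hy
    rwa [mul_sub, mul_one, ← dirac_mul, sub_add_sub_cancel] at this
  inv_mem' {y} hy := by
    have := I.neg_mem (I.mul_mem_left (dirac y⁻¹) hy)
    rw [mul_sub, mul_one, ← dirac_mul, inv_mul_cancel, neg_sub] at this
    exact this

/-- The coordinate ideals contain `h - 1` for unitriangular `h` with arbitrarily large entry, since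
conjugation by powers of `g` expands the coordinate in one of the two directions. -/
theorem exists_large_mem_coordIdeal {i : Fin 2} (hi : Valued.v (![u, v] i : F) ≠ 1) {n : ℕ}
    {x : Fin n → F} {j : Fin n} (hx : x j ≠ 0) (γ : ℤᵐ⁰) :
    ∃ w : F, γ < Valued.v w ∧
      dirac (unip₂ (diagElt u v) (Pi.single i w)) - 1 ∈ coordIdeal k (diagElt u v) i x := by
  obtain ⟨l, hl⟩ := Valued.exists_zpow_mul_gt hi hx γ
  refine ⟨_, hl, ?_⟩
  show _ ∈ unitSubgroup (coordIdeal k (diagElt u v) i x)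
  have hg : gen (diagElt u v) ∈ unitSubgroup (coordIdeal k (diagElt u v) i x) :=
    Submodule.subset_span (Or.inr rfl)
  have hh : unip₂ (diagElt u v) (Pi.single i (x j)) ∈
      unitSubgroup (coordIdeal k (diagElt u v) i x) :=
    Submodule.subset_span (Or.inl ⟨j, rfl⟩)
  have h := Subgroup.mul_mem _ (Subgroup.mul_mem _ (Subgroup.zpow_mem _ hg l) hh)
    (Subgroup.inv_mem _ (Subgroup.zpow_mem _ hg l))
  rw [gen_zpow_mul_unip₂, mul_inv_cancel_right] at h
  convert h using 2
  ext m
  by_cases hm : m = i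
  · subst hm; simp
  · simp [hm]

/-- Finitely many elements of the intersection lie in a common `boundedIdeal`, but the intersection
contains products `(h - 1) * (h' - 1)` with `h` and `h'` having arbitrarily large entries in the two
coordinates. -/
theorem not_fg_coordIdeal_inf (hu : Valued.v (u : F) < 1) (hv : 1 < Valued.v (v : F)) {n : ℕ}
    {x : Fin n → F} (hx : ∃ j, x j ≠ 0) :
    ¬ (coordIdeal k (diagElt u v) 0 x ⊓ coordIdeal k (diagElt u v) 1 x).FG := by
  rintro ⟨Z, hZ⟩
  obtain ⟨j, hj⟩ := hx
  have hZmem : ∀ z ∈ Z, ∃ γ, ∀ i, VanishesAt (diagElt u v) i γ z := by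
    intro z hz
    have h : z ∈ coordIdeal k (diagElt u v) 0 x ⊓ coordIdeal k (diagElt u v) 1 x :=
      hZ ▸ Submodule.subset_span hz
    obtain ⟨γ, hγ⟩ := exists_vanishesAt_of_mem_coordIdeal h.1
    obtain ⟨δ, hδ⟩ := exists_vanishesAt_of_mem_coordIdeal h.2
    refine ⟨max γ δ, fun i => ?_⟩
    fin_cases i
    · exact hγ.mono (le_max_left _ _)
    · exact hδ.mono (le_max_right _ _)
  choose! γ hγ using hZmem
  obtain ⟨Γ, hΓ⟩ := (Z.image γ).exists_le
  -- replace the common bound, which may be zero, by the valuation of a unit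
  obtain ⟨l, hl⟩ := Valued.exists_zpow_mul_gt hu.ne one_ne_zero Γ
  rw [mul_one] at hl
  set c : Fˣ := u ^ l
  have hle : coordIdeal k (diagElt u v) 0 x ⊓ coordIdeal k (diagElt u v) 1 x ≤
      boundedIdeal k (diagElt u v) (Valued.v (c : F)) := by
    rw [← hZ, Submodule.span_le]
    exact fun z hz => mem_boundedIdeal hu hv fun i =>
      (hγ z hz i).mono ((hΓ _ (Finset.mem_image_of_mem γ hz)).trans hl.le)
  obtain ⟨a, ha, haI⟩ := exists_large_mem_coordIdeal (k := k) (i := 0) (v := v) hu.ne hj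
    (Valued.v (c : F))
  obtain ⟨b, hb, hbI⟩ := exists_large_mem_coordIdeal (k := k) (i := 1) (u := u) hv.ne' hj
    (Valued.v (c : F))
  set h₁ := unip₂ (diagElt u v) (Pi.single 0 a) with hh₁
  set h₂ := unip₂ (diagElt u v) (Pi.single 1 b) with hh₂
  have hcomm : h₂ * h₁ = h₁ * h₂ := by
    rw [hh₁, hh₂, unip₂_mul, unip₂_mul, add_comm]
  have hmem : (dirac h₁ - 1) * (dirac h₂ - 1) ∈
      coordIdeal k (diagElt u v) 0 x ⊓ coordIdeal k (diagElt u v) 1 x := by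
    refine ⟨?_, Ideal.mul_mem_left _ _ hbI⟩
    have : (dirac h₁ - 1) * (dirac h₂ - 1) =
        (dirac h₂ - 1) * (dirac h₁ - 1 : AugmentedIwasawaAlgebra k _) := by
      simp only [sub_mul, mul_sub, ← dirac_mul, hcomm, one_mul, mul_one]
      abel
    rw [this]
    exact Ideal.mul_mem_left _ _ haI
  have hclopen : IsClopen {a : Fin 2 → F | ∀ i, Valued.v (a i) ≤ Valued.v (c : F)} := by
    rw [Set.ofPred_forall]
    exact isClopen_iInter_of_finite fun i =>
      (Valued.isClopen_setOf_le c).preimage (continuous_apply i)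
  classical
  let f : LocallyConstant (Fin 2 → F) k := LocallyConstant.charFn k hclopen
  have hf : ∀ a : Fin 2 → F, f a = if ∀ i, Valued.v (a i) ≤ Valued.v (c : F) then 1 else 0 := by
    intro a
    by_cases h : ∀ i, Valued.v (a i) ≤ Valued.v (c : F)
    · rw [if_pos h]; exact Set.indicator_of_mem (s := {a : Fin 2 → F | _}) h _
    · rw [if_neg h]; exact Set.indicator_of_notMem (s := {a : Fin 2 → F | _}) h _
  have hinv : ∀ i, InvariantAt i (Valued.v (c : F)) f := by
    intro i a w hw
    rw [hf, hf]
    congr 1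
    refine propext (forall_congr' fun m => ?_)
    by_cases hm : m = i
    · subst hm
      rw [Pi.add_apply, Pi.single_eq_same]
      refine ⟨fun h => ?_, fun h => (Valuation.map_add _ _ _).trans (max_le h hw)⟩
      have := (Valuation.map_sub Valued.v (a m + w) w).trans (max_le h hw)
      rwa [add_sub_cancel_right] at this
    · rw [Pi.add_apply, Pi.single_eq_of_ne hm, add_zero]
  -- the product evaluates at `f` to `f (a, b) - f (a, 0) - f (0, b) + f (0, 0) = 1`
  have h0 := hle hmem f hinv 1
  have heval : ∀ y, toLin (dirac y) (translate 1 (f.comap (coord (diagElt u v)))) =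
      f (coord (diagElt u v) y) := fun y => congrArg (fun y => f (coord (diagElt u v) y)) (one_mul y)
  have hone : (1 : AugmentedIwasawaAlgebra k (groupG3 (diagElt u v))) = dirac 1 := rfl
  simp only [sub_mul, mul_sub, one_mul, mul_one, ← dirac_mul, hone, map_sub, LinearMap.sub_apply,
    heval] at h0
  rw [hh₁, hh₂, unip₂_mul, coord_unip₂, coord_unip₂, coord_unip₂, coord_one, hf, hf, hf, hf] at h0
  simp [Fin.forall_fin_two, ha.not_ge, hb.not_ge] at h0

theorem idealG3_eq_coordIdeal_sup (g : GL (Fin 3) F) {n : ℕ} (x : Fin n → F) :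
    idealG3 k g x = coordIdeal k g 0 x ⊔ coordIdeal k g 1 x := by
  rw [coordIdeal, coordIdeal, ← Submodule.span_union, idealG3]
  congr 1
  have h₀ : ∀ j, unip₂ g (Pi.single 0 (x j)) = groupG3.unip g (x j) 0 := fun j => by simp [unip₂]
  have h₁ : ∀ j, unip₂ g (Pi.single 1 (x j)) = groupG3.unip g 0 (x j) := fun j => by simp [unip₂]
  simp only [h₀, h₁]
  rw [Set.union_assoc, Set.union_assoc, Set.union_left_comm {_}, Set.union_self]

theorem idealG3_fg (g : GL (Fin 3) F) {n : ℕ} (x : Fin n → F) : (idealG3 k g x).FG := by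
  rw [idealG3_eq_coordIdeal_sup]
  exact Submodule.FG.sup (coordIdeal_fg g 0 x) (coordIdeal_fg g 1 x)

theorem not_finitePresentation_idealG3 (hu : Valued.v (u : F) < 1) (hv : 1 < Valued.v (v : F))
    {n : ℕ} {x : Fin n → F} (hx : ∃ j, x j ≠ 0) :
    ¬ Module.FinitePresentation (AugmentedIwasawaAlgebra k (groupG3 (diagElt u v)))
      (idealG3 k (diagElt u v) x) := by
  rw [idealG3_eq_coordIdeal_sup]
  exact fun h => not_fg_coordIdeal_inf hu hv hx
    (Submodule.fg_inf_of_finitePresentation_sup (coordIdeal_fg _ 0 x) (coordIdeal_fg _ 1 x) h)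

end Obstruction

/-! ### Failure of coherence -/

section Order

variable {F : Type*} [Field F] [Valued F ℤᵐ⁰]

theorem ordVal_pos_iff {x : F} (hx : x ≠ 0) : 0 < ordVal x ↔ Valued.v x < 1 := by
  rw [ordVal, Left.neg_pos_iff, ← WithZero.log_one,
    WithZero.log_lt_log ((Valuation.ne_zero_iff _).2 hx) one_ne_zero]

theorem ordVal_neg_iff {x : F} (hx : x ≠ 0) : ordVal x < 0 ↔ 1 < Valued.v x := by
  rw [ordVal, Left.neg_neg_iff, ← WithZero.log_one,
    WithZero.log_lt_log one_ne_zero ((Valuation.ne_zero_iff _).2 hx)]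

/-- The powers of `p` tend to `0` in `F`, as they do in `ℚ_p`. -/
theorem ordVal_natCast_prime_pos (p : ℕ) [Fact p.Prime] [Algebra ℚ_[p] F]
    (hcont : Continuous (algebraMap ℚ_[p] F)) : 0 < ordVal (p : F) := by
  have hp : (p : F) ≠ 0 := by
    rw [← map_natCast (algebraMap ℚ_[p] F), map_ne_zero]
    exact_mod_cast (Fact.out : p.Prime).ne_zero
  have ht : Filter.Tendsto (fun m : ℕ => (p : F) ^ m) Filter.atTop (nhds 0) := by
    have h := (hcont.tendsto 0).comp
      (tendsto_pow_atTop_nhds_zero_of_norm_lt_one (Padic.norm_p_lt_one (p := p)))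
    simpa [Function.comp_def] using h
  have hev : ∀ᶠ y : F in nhds 0, Valued.v y < 1 := by
    rw [Filter.Eventually, Valued.mem_nhds_zero]
    exact ⟨1, fun y hy => by simpa using hy⟩
  obtain ⟨m, hm⟩ := (ht.eventually hev).exists
  rw [map_pow] at hm
  exact (ordVal_pos_iff hp).2 (lt_of_not_ge fun h => hm.not_ge (one_le_pow_of_one_le' h m))

end Order

theorem mainTheorem1 (p : ℕ) [Fact p.Prime] (k : Type*) [Field k] [CharP k p]
    (F : Type*) [Field F] [Valued F ℤᵐ⁰] [Algebra ℚ_[p] F] [FiniteDimensional ℚ_[p] F]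
    (hcont : Continuous (algebraMap ℚ_[p] F))
    (hsurj : Function.Surjective (Valued.v : Valuation F ℤᵐ⁰))
    (u v : Fˣ) (hu : 0 < ordVal (u : F)) (hv : ordVal (v : F) < 0) :
    ¬ IsLeftCoherent (AugmentedIwasawaAlgebra k (groupG3 (diagElt u v))) ∧
    ¬ IsRightCoherent (AugmentedIwasawaAlgebra k (groupG3 (diagElt u v))) ∧
    ∀ (n : ℕ) (x : Fin n → F), IsIntegralBasis p x →
      (idealG3 k (diagElt u v ^ ordVal (p : F)) x).FG ∧
      ¬ Module.FinitePresentation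
        (AugmentedIwasawaAlgebra k (groupG3 (diagElt u v ^ ordVal (p : F))))
        (idealG3 k (diagElt u v ^ ordVal (p : F)) x) := by
  have hu' := (ordVal_pos_iff u.ne_zero).1 hu
  have hv' := (ordVal_neg_iff v.ne_zero).1 hv
  have hx₁ : ∃ j, (fun _ : Fin 1 => (1 : F)) j ≠ 0 := ⟨0, one_ne_zero⟩
  refine ⟨fun h => not_finitePresentation_idealG3 hu' hv' hx₁ (h _ (idealG3_fg _ _)),
    not_isRightCoherent_of_not_fg_inf (AugmentedIwasawaAlgebra.opEquiv k _)
      (coordIdeal_fg _ 0 _) (coordIdeal_fg _ 1 _) (not_fg_coordIdeal_inf hu' hv' hx₁),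
    fun n x hx => ⟨idealG3_fg _ _, ?_⟩⟩
  have hp := ordVal_natCast_prime_pos p hcont
  generalize ordVal (p : F) = e at hp ⊢
  lift e to ℕ using hp.le
  have he : e ≠ 0 := by rintro rfl; exact lt_irrefl _ hp
  rw [diagElt_zpow]
  refine not_finitePresentation_idealG3 ?_ ?_ ?_
  · rw [zpow_natCast, Units.val_pow_eq_pow_val, map_pow]
    exact pow_lt_one' hu' he
  · rw [zpow_natCast, Units.val_pow_eq_pow_val, map_pow]
    exact one_lt_pow' hv' he
  · -- `1` is an integral combination of the `x j`, so these are not all zero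
    obtain ⟨c, hc⟩ := (hx.2 1).1 (map_one _).le
    by_contra! h0
    exact one_ne_zero (hc.trans (Finset.sum_eq_zero fun j _ => by rw [h0 j, smul_zero]))
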